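/- Let $k \ge 1$ be an integer and let $\mathcal{H}$ be the family of all (open or closed) half-planes in $\mathbb{R}^2$. A $k$-coloring of a finite set $P \subset \mathbb{R}^2$ is a function $\chi : P \to \{1,\dots,k\}$, and a half-plane $h$ is polychromatic for $\chi$ if $h \cap P$ contains a point of each of the $k$ colors. Let $f_{\mathcal{H}}(k)$ be the minimum number $f$ such that every finite set $P \subset \mathbb{R}^2$ has a $k$-coloring for which every half-plane containing at least $f$ points of $P$ is polychromatic. Then this minimum exists and $f_{\mathcal{H}}(k) = 2k-1$. Moreover, for every integer $n \ge 2k-1$ there is a set $P \subset \mathbb{R}^2$ of exactly $n$ points and a subset $\Gamma \subseteq P$ of exactly $2k-1$ points lying on the parabola arc $\{(x,y) : y = x^2,\ -1 < x < 1\}$ such that, for every $k$-coloring of $P$, there is an open half-plane that contains exactly $2k-2$ points of $P$, all of them belonging to $\Gamma$, and that is not polychromatic. -/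

import Mathlib

namespace PolychromaticColoring

/-- A region `R` is polychromatic with respect to the `k`-coloring `χ` of the finite point set `P`
if it contains a point of `P` from each of the `k` color classes. -/
def IsPolychromatic {X : Type*} {P : Finset X} {k : ℕ} (χ : {p : X // p ∈ P} → Fin k)
    (R : Set X) : Prop :=
  ∀ i : Fin k, ∃ p : {p : X // p ∈ P}, (p : X) ∈ R ∧ χ p = i

/-- Every finite point set `P` can be `k`-colored so that every range `R ∈ 𝓡` containing
at least `f` points of `P` is polychromatic. -/
def IsThreshold {X : Type*} (𝓡 : Set (Set X)) (k f : ℕ) : Prop :=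
  ∀ P : Finset X, ∃ χ : {p : X // p ∈ P} → Fin k,
    ∀ R ∈ 𝓡, f ≤ ((P : Set X) ∩ R).ncard → IsPolychromatic χ R

/-- `f_𝓡(k) = m`: the minimum `f` that is a threshold for `𝓡` and `k` exists and equals `m`. -/
def PolychromaticNumberEq {X : Type*} (𝓡 : Set (Set X)) (k m : ℕ) : Prop :=
  IsLeast {f : ℕ | IsThreshold 𝓡 k f} m

/-- The Euclidean plane. -/
abbrev Plane : Type := EuclideanSpace ℝ (Fin 2)

/-- The open half-planes `{x | ⟨a, x⟩ > c}` with `a ≠ 0`. -/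
def openHalfPlanes : Set (Set Plane) :=
  {h | ∃ (a : Plane) (c : ℝ), a ≠ 0 ∧ h = {x : Plane | c < inner ℝ a x}}

/-- The closed half-planes `{x | ⟨a, x⟩ ≥ c}` with `a ≠ 0`. -/
def closedHalfPlanes : Set (Set Plane) :=
  {h | ∃ (a : Plane) (c : ℝ), a ≠ 0 ∧ h = {x : Plane | c ≤ inner ℝ a x}}

/-- The family of all half-planes, open or closed. -/
def halfPlanes : Set (Set Plane) := openHalfPlanes ∪ closedHalfPlanes

end PolychromaticColoring

namespace PolychromaticColoring

/-! Upper bound: color greedily, one class at a time. Among the extreme points of `P`, take an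
inclusion-minimal set `N` meeting every hemispace with at least `m = 2k+1` points. If each hemispace
with exactly `m` points contains at most two points of `N`, then `N` can serve as one color class:
at least `2k-1` points survive its removal, and induction colors the rest (`exists_coloring`).

Suppose instead that three points of `N` lie in such a hemispace `h`. By minimality each has a
private hemispace, which by counting contains a point of `P` outside `h`. Each outer point lies
beyond exactly one side of the triangle of the three, and not the side opposite its own vertex.
Hence two outer points lie beyond different sides, which extremality and the convexity of `h` and
`hᶜ` forbid (`false_of_three_separated`).

Half-planes may gain several points at once. Hemispaces given by a lexicographic order break ties,
so every half-plane with at least `m` points can be cut down to exactly `m`.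

Lower bound: of `2k-1` points on the parabola, some color occurs at most once. The open half-plane
above the tangent at its only bearer contains the other `2k-2` points and misses that color. -/

/-- A hemispace is a convex set with convex complement. -/
def IsHemispace {E : Type*} [AddCommGroup E] [Module ℝ E] (h : Set E) : Prop :=
  Convex ℝ h ∧ Convex ℝ hᶜ

theorem Convex.inv_smul_sum_mem {E ι : Type*} [AddCommGroup E] [Module ℝ E] [Fintype ι]
    {s : Set E} (hs : Convex ℝ s) {w : ι → ℝ} {z : ι → E} (hw : ∀ i, 0 ≤ w i) {W : ℝ}
    (hW : ∑ i, w i = W) (hpos : 0 < W) (hz : ∀ i, z i ∈ s) :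
    W⁻¹ • ∑ i, w i • z i ∈ s := by
  rw [Finset.smul_sum]
  simp only [smul_smul]
  refine hs.sum_mem (fun i _ => by have := hw i; positivity) ?_ (fun i _ => hz i)
  rw [← Finset.mul_sum, hW, inv_mul_cancel₀ hpos.ne']

theorem Convex.combo_two_mem {E : Type*} [AddCommGroup E] [Module ℝ E] {s : Set E}
    (hs : Convex ℝ s) {x y : E} {a b W : ℝ} (ha : 0 ≤ a) (hb : 0 ≤ b) (hW : a + b = W)
    (hpos : 0 < W) (hx : x ∈ s) (hy : y ∈ s) : W⁻¹ • (a • x + b • y) ∈ s := by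
  have := Convex.inv_smul_sum_mem hs (w := ![a, b]) (z := ![x, y])
    (by intro i; fin_cases i <;> simp [ha, hb]) (by simpa using hW) hpos
    (by intro i; fin_cases i <;> simp [hx, hy])
  simpa using this

theorem Convex.combo_three_mem {E : Type*} [AddCommGroup E] [Module ℝ E] {s : Set E}
    (hs : Convex ℝ s) {x y z : E} {a b c W : ℝ} (ha : 0 ≤ a) (hb : 0 ≤ b) (hc : 0 ≤ c)
    (hW : a + b + c = W) (hpos : 0 < W) (hx : x ∈ s) (hy : y ∈ s) (hz : z ∈ s) :
    W⁻¹ • (a • x + b • y + c • z) ∈ s := by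
  have := Convex.inv_smul_sum_mem hs (w := ![a, b, c]) (z := ![x, y, z])
    (by intro i; fin_cases i <;> simp [ha, hb, hc])
    (by simpa [Fin.sum_univ_three] using hW) hpos
    (by intro i; fin_cases i <;> simp [hx, hy, hz])
  simpa [Fin.sum_univ_three] using this

/-! ### Outer points of a triangle with extreme vertices -/

section Barycentric

variable {E : Type*} [AddCommGroup E] [Module ℝ E]

/-- Two points `x`, `y` outside a hemispace that contains `q`, `r` cannot lie beyond different
sides of the triangle `p q r`, if `r` is separated from `q`, `x`, `y`. -/
theorem false_of_beyond_two_sides {h : Set E} (hh : IsHemispace h) {p q r x y : E}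
    (hq : q ∈ h) (hr : r ∈ h) (hx : x ∉ h) (hy : y ∉ h) {s : Set E} (hs : Convex ℝ s)
    (hrs : r ∉ s) (hqs : q ∈ s) (hxs : x ∈ s) (hys : y ∈ s)
    {a b c a' b' c' : ℝ} (h1 : a + b + c = 1) (h1' : a' + b' + c' = 1)
    (ex : x = a • p + b • q + c • r) (ey : y = a' • p + b' • q + c' • r)
    (ha : 0 ≤ a) (hc : 0 ≤ c) (ha' : a' < 0) (hc' : 0 ≤ c') : False := by
  -- The weights cancel `p`, giving the point where the segment `x y` meets the line `q r`.
  have key : (-a') • x + a • y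
      = (a * b' - a' * b) • q + (a * c' - a' * c) • r := by
    rw [ex, ey]; module
  have hpos : 0 < -a' + a := by linarith
  have hsum : (a * b' - a' * b) + (a * c' - a' * c) = -a' + a := by
    linear_combination a * h1' - a' * h1
  have hR : 0 ≤ a * c' - a' * c := by nlinarith
  -- Either this point lies on the segment `q r`, hence in both `h` and `hᶜ`, or solving for `r`
  -- puts it in the hull of `x`, `y`, `q`.
  rcases le_total 0 (a * b' - a' * b) with hQ | hQ
  · have m1 := Convex.combo_two_mem hh.2 (by linarith) ha rfl hpos hx hy
    have m2 := Convex.combo_two_mem hh.1 hQ hR hsum hpos hq hr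
    rw [key] at m1
    exact m1 m2
  · have hRpos : 0 < a * c' - a' * c := by linarith
    have m := Convex.combo_three_mem hs (x := x) (y := y) (z := q) (a := -a') (b := a)
      (c := -(a * b' - a' * b)) (W := a * c' - a' * c) (by linarith) ha (by linarith)
      (by linarith) hRpos hxs hys hqs
    rw [key, show (a * b' - a' * b) • q + (a * c' - a' * c) • r + (-(a * b' - a' * b)) • q
      = (a * c' - a' * c) • r by module, smul_smul, inv_mul_cancel₀ hRpos.ne', one_smul] at m
    exact hrs m

/-- A point `x` outside a hemispace containing the triangle `p q r`, such that no vertex of the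
triangle lies in the hull of the other points, is beyond exactly one side of the triangle. -/
theorem nonneg_of_neg {p q r x : E} {s t : Set E} (hs : Convex ℝ s)
    (hrs : r ∉ s) (hps : p ∈ s) (hqs : q ∈ s) (hxs : x ∈ s) (ht : Convex ℝ t) (hqt : q ∉ t)
    (hpt : p ∈ t) (hrt : r ∈ t) (hxt : x ∈ t) {a b c : ℝ}
    (h1 : a + b + c = 1) (ex : x = a • p + b • q + c • r) (ha : a < 0) : 0 ≤ b ∧ 0 ≤ c := by
  constructor
  -- With `a` and `b` both negative, solving for `r` puts it in the hull of `x`, `p`, `q`.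
  · by_contra! hb
    have hc : 0 < c := by linarith
    have m := Convex.combo_three_mem hs (x := x) (y := p) (z := q) (a := 1) (b := -a)
      (c := -b) (W := c) (by simp) (by linarith) (by linarith) (by linarith) hc hxs hps hqs
    rw [ex, show (1 : ℝ) • (a • p + b • q + c • r) + (-a) • p + (-b) • q = c • r by module,
      smul_smul, inv_mul_cancel₀ hc.ne', one_smul] at m
    exact hrs m
  · by_contra! hc
    have hb : 0 < b := by linarith
    have m := Convex.combo_three_mem ht (x := x) (y := p) (z := r) (a := 1) (b := -a)
      (c := -c) (W := b) (by simp) (by linarith) (by linarith) (by linarith) hb hxt hpt hrt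
    rw [ex, show (1 : ℝ) • (a • p + b • q + c • r) + (-a) • p + (-c) • r = b • q by module,
      smul_smul, inv_mul_cancel₀ hb.ne', one_smul] at m
    exact hqt m

/-- A set that contains a vertex `p` of a triangle and a point beyond the opposite side, but no
other vertex, is not a hemispace. -/
theorem nonneg_of_mem_hemispace {g : Set E} (hg : IsHemispace g) {p q r x : E} (hp : p ∈ g)
    (hq : q ∉ g) (hr : r ∉ g) (hx : x ∈ g) {a b c : ℝ} (h1 : a + b + c = 1)
    (ex : x = a • p + b • q + c • r) (hb : 0 ≤ b) (hc : 0 ≤ c) : 0 ≤ a := by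
  by_contra! ha
  have hW : 0 < b + c := by linarith
  have m1 := Convex.combo_two_mem hg.1 (x := x) (y := p) (a := 1) (b := -a) (W := b + c)
    (by simp) (by linarith) (by linarith) hW hx hp
  have m2 := Convex.combo_two_mem hg.2 hb hc rfl hW hq hr
  rw [ex, show (1 : ℝ) • (a • p + b • q + c • r) + (-a) • p = b • q + c • r by module] at m1
  exact m2 m1

end Barycentric

/-- Three extreme points in the plane are affinely independent, in coordinates. -/
theorem exists_barycentric {p q r : Plane} {P : Set Plane}
    (hp : p ∈ P) (hq : q ∈ P) (hr : r ∈ P) (hpq : p ≠ q) (hqr : q ≠ r) (hpr : p ≠ r)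
    (ep : p ∉ convexHull ℝ (P \ {p})) (eq : q ∉ convexHull ℝ (P \ {q}))
    (er : r ∉ convexHull ℝ (P \ {r})) (x : Plane) :
    ∃ a b c : ℝ, a + b + c = 1 ∧ x = a • p + b • q + c • r := by
  have hind : AffineIndependent ℝ ![p, q, r] := by
    rw [affineIndependent_iff_not_collinear_set]
    intro hcol
    have hmem : ∀ {u v : Plane}, u ∈ P → u ≠ v → u ∈ convexHull ℝ (P \ {v}) :=
      fun hu huv => subset_convexHull ℝ _ ⟨hu, huv⟩
    have hbt : ∀ {u v w : Plane}, u ∈ P → w ∈ P → u ≠ v → w ≠ v → Wbtw ℝ u v w →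
        v ∈ convexHull ℝ (P \ {v}) := fun hu hw huv hwv hb =>
      (convex_convexHull ℝ _).segment_subset (hmem hu huv) (hmem hw hwv)
        (mem_segment_iff_wbtw.2 hb)
    rcases hcol.wbtw_or_wbtw_or_wbtw with hb | hb | hb
    · exact eq (hbt hp hr hpq hqr.symm hb)
    · exact er (hbt hq hp hqr hpr hb)
    · exact ep (hbt hr hq hpr.symm hpq.symm hb)
  have htop : affineSpan ℝ (Set.range ![p, q, r]) = ⊤ := by
    rw [hind.affineSpan_eq_top_iff_card_eq_finrank_add_one]
    simp
  let B : AffineBasis (Fin 3) ℝ Plane := ⟨![p, q, r], hind, htop⟩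
  refine ⟨B.coord 0 x, B.coord 1 x, B.coord 2 x, ?_, ?_⟩
  · rw [← Fin.sum_univ_three (fun i => B.coord i x)]
    exact B.sum_coord_apply_eq_one x
  · have := B.linear_combination_coord_eq_self x
    rw [Fin.sum_univ_three] at this
    exact this.symm

/-- Three extreme points `v i` of `P` in a hemispace `h` cannot be separated from each other by
hemispaces `g i` all of which contain points of `P` outside `h`. -/
theorem false_of_three_separated {P : Set Plane} {h : Set Plane} (hh : IsHemispace h)
    (v x : Fin 3 → Plane) (g : Fin 3 → Set Plane) (hinj : Function.Injective v)
    (hvP : ∀ i, v i ∈ P) (hv : ∀ i, v i ∉ convexHull ℝ (P \ {v i})) (hvh : ∀ i, v i ∈ h)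
    (hxP : ∀ i, x i ∈ P) (hxh : ∀ i, x i ∉ h) (hg : ∀ i, IsHemispace (g i))
    (hxg : ∀ i, x i ∈ g i) (hvg : ∀ i j, v j ∈ g i ↔ j = i) : False := by
  have hmem : ∀ {u : Plane} (j), u ∈ P → u ≠ v j → u ∈ convexHull ℝ (P \ {v j}) :=
    fun j hu huv => subset_convexHull ℝ _ ⟨hu, huv⟩
  have hvj : ∀ i j, i ≠ j → v i ∈ convexHull ℝ (P \ {v j}) :=
    fun i j hij => hmem j (hvP i) (fun e => hij (hinj e))
  have hxj : ∀ i j, x i ∈ convexHull ℝ (P \ {v j}) :=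
    fun i j => hmem j (hxP i) (fun e => hxh i (e ▸ hvh j))
  have hconv : ∀ j, Convex ℝ (convexHull ℝ (P \ {v j})) := fun j => convex_convexHull ℝ _
  -- every outer point is beyond some side, not opposite to its own vertex
  have hside : ∀ i, ∃ j l m : Fin 3, j ≠ i ∧ j ≠ l ∧ j ≠ m ∧ l ≠ m ∧ ∃ a b c : ℝ, a + b + c = 1 ∧
      x i = a • v j + b • v l + c • v m ∧ a < 0 ∧ 0 ≤ b ∧ 0 ≤ c := by
    intro i
    obtain ⟨j, l, hji, hli, hjl⟩ : ∃ j l : Fin 3, j ≠ i ∧ l ≠ i ∧ j ≠ l := by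
      fin_cases i
      · exact ⟨1, 2, by decide, by decide, by decide⟩
      · exact ⟨0, 2, by decide, by decide, by decide⟩
      · exact ⟨0, 1, by decide, by decide, by decide⟩
    obtain ⟨a, b, c, h1, ex⟩ := exists_barycentric (hvP i) (hvP j) (hvP l)
      (hinj.ne hji.symm) (hinj.ne hjl) (hinj.ne hli.symm) (hv i) (hv j) (hv l) (x i)
    by_cases hb : b < 0
    · have e2 : x i = b • v j + a • v i + c • v l := by rw [ex]; module
      have h2 : b + a + c = 1 := by linarith
      exact ⟨j, i, l, hji, hji, hjl, hli.symm, b, a, c, h2, e2, hb,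
        nonneg_of_neg (hconv l) (hv l) (hvj j l hjl) (hvj i l hli.symm) (hxj i l) (hconv i) (hv i)
          (hvj j i hji) (hvj l i hli) (hxj i i) h2 e2 hb⟩
    by_cases hc : c < 0
    · have e2 : x i = c • v l + a • v i + b • v j := by rw [ex]; module
      have h2 : c + a + b = 1 := by linarith
      exact ⟨l, i, j, hli, hli, hjl.symm, hji.symm, c, a, b, h2, e2, hc,
        nonneg_of_neg (hconv j) (hv j) (hvj l j hjl.symm) (hvj i j hji.symm) (hxj i j) (hconv i)
          (hv i) (hvj l i hli) (hvj j i hji) (hxj i i) h2 e2 hc⟩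
    push Not at hb hc
    -- The private hemispace rules out the side opposite `v i`. With no negative coordinate left, `x
    -- i` would lie in the triangle, hence in `h`.
    have ha : 0 ≤ a := nonneg_of_mem_hemispace (hg i) ((hvg i i).2 rfl)
      (fun e => hji ((hvg i j).1 e)) (fun e => hli ((hvg i l).1 e)) (hxg i) h1 ex hb hc
    refine absurd ?_ (hxh i)
    have m := Convex.combo_three_mem hh.1 ha hb hc h1 one_pos (hvh i) (hvh j) (hvh l)
    rwa [inv_one, one_smul, ← ex] at m
  obtain ⟨j, l, m, -, hjl, hjm, hlm, a, b, c, h1, ex, ha, hb, hc⟩ := hside 0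
  obtain ⟨j', l', m', hj', hjl', hjm', hlm', a', b', c', h1', ey, ha', hb', hc'⟩ := hside j
  -- `x 0` is beyond the side opposite to `v j`, and `x j` beyond the one opposite to `v j' ≠ v j`
  obtain ⟨n, hnj, hnj', b₁, c₁, h2, e2, hb₁, hc₁⟩ : ∃ n, n ≠ j ∧ n ≠ j' ∧ ∃ b₁ c₁ : ℝ,
      a + b₁ + c₁ = 1 ∧ x 0 = a • v j + b₁ • v j' + c₁ • v n ∧ 0 ≤ b₁ ∧ 0 ≤ c₁ := by
    obtain rfl | rfl : j' = l ∨ j' = m := by omega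
    · exact ⟨m, hjm.symm, hlm.symm, b, c, h1, ex, hb, hc⟩
    · exact ⟨l, hjl.symm, hlm, c, b, by linarith, by rw [ex]; module, hc, hb⟩
  obtain ⟨b₂, c₂, h3, e3, hb₂, hc₂⟩ : ∃ b₂ c₂ : ℝ,
      b₂ + a' + c₂ = 1 ∧ x j = b₂ • v j + a' • v j' + c₂ • v n ∧ 0 ≤ b₂ ∧ 0 ≤ c₂ := by
    obtain ⟨rfl, rfl⟩ | ⟨rfl, rfl⟩ : (l' = j ∧ m' = n) ∨ (l' = n ∧ m' = j) := by omega
    · exact ⟨b', c', by linarith, by rw [ey]; module, hb', hc'⟩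
    · exact ⟨c', b', by linarith, by rw [ey]; module, hc', hb'⟩
  exact false_of_beyond_two_sides hh (hvh j') (hvh n) (hxh j) (hxh 0) (hconv n) (hv n)
    (hvj j' n hnj'.symm) (hxj j n) (hxj 0 n) h3 h2 e3 e2 hb₂ hc₂ ha hc₁

/-! ### Minimal hitting sets -/

/-- The extreme points of a finite set meet every hemispace that the set meets. -/
theorem exists_extreme_hitting (P : Finset Plane) :
    ∃ V ⊆ P, (∀ p ∈ V, p ∉ convexHull ℝ ((P : Set Plane) \ {p})) ∧
      ∀ h : Set Plane, IsHemispace h → (∃ p ∈ P, p ∈ h) → ∃ p ∈ V, p ∈ h := by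
  classical
  set A := convexHull ℝ (P : Set Plane)
  have hsub : A.extremePoints ℝ ⊆ P := extremePoints_convexHull_subset
  refine ⟨P.filter (· ∈ A.extremePoints ℝ), Finset.filter_subset _ _, ?_, ?_⟩
  · intro p hp hmem
    have hp' := (Finset.mem_filter.1 hp).2
    rw [(convex_convexHull ℝ _).mem_extremePoints_iff_convex_sdiff] at hp'
    exact (convexHull_min (Set.sdiff_subset_sdiff_left (subset_convexHull ℝ _)) hp'.2 hmem).2 rfl
  · rintro h hh ⟨p, hpP, hph⟩
    by_contra! hV
    have hfin : (A.extremePoints ℝ).Finite := P.finite_toSet.subset hsub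
    have hK := closure_convexHull_extremePoints (P.finite_toSet.isCompact_convexHull (𝕜 := ℝ))
      (convex_convexHull ℝ (P : Set Plane))
    rw [(hfin.isClosed_convexHull (𝕜 := ℝ)).closure_eq] at hK
    have hp : p ∈ convexHull ℝ (A.extremePoints ℝ) := by
      rw [hK]; exact subset_convexHull ℝ _ hpP
    exact convexHull_min (fun y hy => hV y (Finset.mem_filter.2 ⟨hsub hy, hy⟩)) hh.2 hp hph

open Classical in
/-- There is a hitting set for the hemispaces with at least `m` points that has at most two points
in every hemispace with exactly `m` points. -/
theorem exists_sparse_hitting_set (P : Finset Plane) {m : ℕ} (hm : 1 ≤ m) :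
    ∃ N ⊆ P, ∀ h : Set Plane, IsHemispace h →
      (m ≤ (P.filter (· ∈ h)).card → ∃ p ∈ N, p ∈ h) ∧
      ((P.filter (· ∈ h)).card = m → (N.filter (· ∈ h)).card ≤ 2) := by
  obtain ⟨V, hVP, hVext, hVhit⟩ := exists_extreme_hitting P
  let hits : Finset Plane → Prop := fun N => ∀ h : Set Plane, IsHemispace h →
    m ≤ (P.filter (· ∈ h)).card → ∃ p ∈ N, p ∈ h
  have hV : hits V := fun h hh hc => hVhit h hh <| by
    obtain ⟨p, hp⟩ := Finset.card_pos.1 (hm.trans hc)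
    exact ⟨p, (Finset.mem_filter.1 hp).1, (Finset.mem_filter.1 hp).2⟩
  obtain ⟨N, hNV, hN, hmin⟩ := exists_minimal_le_of_wellFoundedLT hits V hV
  refine ⟨N, hNV.trans hVP, fun h hh => ⟨hN h hh, fun hcard => ?_⟩⟩
  by_contra! h3
  obtain ⟨a, b, c, ha, hb, hc, hab, hac, hbc⟩ := Finset.two_lt_card_iff.1 h3
  have hwit : ∀ q ∈ N, ∃ g : Set Plane, IsHemispace g ∧ m ≤ (P.filter (· ∈ g)).card ∧
      ∀ p ∈ N, p ∈ g ↔ p = q := by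
    intro q hq
    have hnot : ¬ hits (N.erase q) := fun hit =>
      Finset.notMem_erase q N (hmin hit (Finset.erase_subset q N) hq)
    simp only [hits] at hnot
    push Not at hnot
    obtain ⟨g, hg, hgm, hgq⟩ := hnot
    have honly : ∀ p ∈ N, p ∈ g → p = q := fun p hp hpg => by
      by_contra hne
      exact hgq p (Finset.mem_erase.2 ⟨hne, hp⟩) hpg
    obtain ⟨p, hp, hpg⟩ := hN g hg hgm
    exact ⟨g, hg, hgm, fun p' hp' => ⟨honly p' hp', fun e => by
      rw [e, ← honly p hp hpg]; exact hpg⟩⟩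
  have hvN : ∀ i : Fin 3, ![a, b, c] i ∈ N ∧ ![a, b, c] i ∈ h := by
    intro i
    fin_cases i
    exacts [Finset.mem_filter.1 ha, Finset.mem_filter.1 hb, Finset.mem_filter.1 hc]
  have hinj : Function.Injective ![a, b, c] := by
    intro i j
    fin_cases i <;> fin_cases j <;> simp [hab, hac, hbc, hab.symm, hac.symm, hbc.symm]
  choose g hg hgm hgN using fun i => hwit _ (hvN i).1
  have hout : ∀ i, ∃ x ∈ P, x ∈ g i ∧ x ∉ h := by
    intro i
    by_contra! hall
    obtain ⟨j, hji⟩ := exists_ne i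
    -- The inclusion is strict because another of the three points is in `h` but not in `g i`; this
    -- contradicts `m ≤` the number of points in `g i`.
    have hss : P.filter (· ∈ g i) ⊂ P.filter (· ∈ h) := by
      refine Finset.ssubset_iff_subset_ne.2 ⟨fun x hx => ?_, fun e => ?_⟩
      · obtain ⟨hxP, hxg⟩ := Finset.mem_filter.1 hx
        exact Finset.mem_filter.2 ⟨hxP, hall x hxP hxg⟩
      · have : ![a, b, c] j ∈ P.filter (· ∈ h) :=
          Finset.mem_filter.2 ⟨hVP (hNV (hvN j).1), (hvN j).2⟩
        rw [← e] at this
        exact hji (hinj ((hgN i _ (hvN j).1).1 (Finset.mem_filter.1 this).2))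
    have := Finset.card_lt_card hss
    have := hgm i
    omega
  choose x hxP hxg hxh using hout
  exact false_of_three_separated (P := (P : Set Plane)) hh ![a, b, c] x g hinj
    (fun i => hVP (hNV (hvN i).1)) (fun i => hVext _ (hNV (hvN i).1)) (fun i => (hvN i).2)
    hxP hxh hg hxg (fun i j => by rw [hgN i _ (hvN j).1, hinj.eq_iff])

/-! ### Lexicographic tie-breaking -/

theorem isHemispace_lex {E : Type*} [AddCommGroup E] [Module ℝ E] (f g : E →ₗ[ℝ] ℝ)
    (c d : ℝ) : IsHemispace {x | toLex (c, d) ≤ toLex (f x, g x)} := by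
  constructor
  · rw [convex_iff_forall_pos]
    intro x hx y hy s t hs ht hst
    simp only [Set.mem_ofPred_eq, Prod.Lex.toLex_le_toLex, map_add, map_smul, smul_eq_mul]
      at hx hy ⊢
    have ec : c = s * c + t * c := by rw [← add_mul, hst, one_mul]
    have ed : d = s * d + t * d := by rw [← add_mul, hst, one_mul]
    rcases hx with hx | ⟨hx, hx'⟩
    · left
      have h1 := mul_lt_mul_of_pos_left hx hs
      have h2 : t * c ≤ t * f y :=
        mul_le_mul_of_nonneg_left (hy.elim le_of_lt fun h => h.1.le) ht.le
      linarith
    rcases hy with hy | ⟨hy, hy'⟩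
    · left
      have h1 := mul_lt_mul_of_pos_left hy ht
      rw [← hx]
      linarith
    · right
      rw [← hx, ← hy]
      refine ⟨ec, ?_⟩
      have h1 := mul_le_mul_of_nonneg_left hx' hs.le
      have h2 := mul_le_mul_of_nonneg_left hy' ht.le
      linarith
  · rw [convex_iff_forall_pos]
    intro x hx y hy s t hs ht hst
    simp only [Set.mem_compl_iff, Set.mem_ofPred_eq, not_le, Prod.Lex.toLex_lt_toLex, map_add,
      map_smul, smul_eq_mul] at hx hy ⊢
    have ec : c = s * c + t * c := by rw [← add_mul, hst, one_mul]
    have ed : d = s * d + t * d := by rw [← add_mul, hst, one_mul]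
    rcases hx with hx | ⟨hx, hx'⟩
    · left
      have h1 := mul_lt_mul_of_pos_left hx hs
      have h2 : t * f y ≤ t * c :=
        mul_le_mul_of_nonneg_left (hy.elim le_of_lt fun h => h.1.le) ht.le
      linarith
    rcases hy with hy | ⟨hy, hy'⟩
    · left
      have h1 := mul_lt_mul_of_pos_left hy ht
      rw [hx]
      linarith
    · right
      rw [hx, hy]
      refine ⟨ec.symm, ?_⟩
      have h1 := mul_lt_mul_of_pos_left hx' hs
      have h2 := mul_lt_mul_of_pos_left hy' ht
      linarith

/-- Deleting the point of least key until `m` points are left, the least survivor is `t`.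
Injectivity keeps the deleted points strictly below `t`. -/
theorem exists_card_filter_le_eq {α β : Type*} [DecidableEq α] [LinearOrder β] (key : α → β)
    (hkey : Function.Injective key) {m : ℕ} (hm : 1 ≤ m) (Q : Finset α) (hQ : m ≤ Q.card) :
    ∃ t ∈ Q, (Q.filter (fun x => key t ≤ key x)).card = m := by
  induction hQ' : Q.card - m generalizing Q with
  | zero =>
    obtain ⟨t, ht, hmin⟩ := Q.exists_min_image key (Finset.card_pos.1 (hm.trans hQ))
    refine ⟨t, ht, ?_⟩
    rw [Finset.filter_true_of_mem hmin]
    omega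
  | succ n ih =>
    obtain ⟨q, hq, hmin⟩ := Q.exists_min_image key (Finset.card_pos.1 (hm.trans hQ))
    have hcard := Finset.card_erase_of_mem hq
    obtain ⟨t, ht, htm⟩ := ih (Q.erase q) (by omega) (by omega)
    obtain ⟨htq, htQ⟩ := Finset.mem_erase.1 ht
    refine ⟨t, htQ, ?_⟩
    rw [← htm, Finset.filter_erase, Finset.erase_eq_of_notMem]
    intro hmem
    exact htq (hkey (le_antisymm (Finset.mem_filter.1 hmem).2 (hmin t htQ)))

open Classical in
/-- A half-plane with at least `m` points contains the points of a hemispace with exactly `m`. -/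
theorem exists_hemispace_card_eq (P : Finset Plane) {R : Set Plane} (hR : R ∈ halfPlanes)
    {m : ℕ} (hm : 1 ≤ m) (hcard : m ≤ (P.filter (· ∈ R)).card) :
    ∃ h : Set Plane, IsHemispace h ∧ (∀ p ∈ P, p ∈ h → p ∈ R) ∧
      (P.filter (· ∈ h)).card = m := by
  obtain ⟨a, ha, hup⟩ : ∃ a : Plane, a ≠ 0 ∧
      ∀ x y, x ∈ R → inner ℝ a x ≤ inner ℝ a y → y ∈ R := by
    rcases hR with ⟨a, c, ha, rfl⟩ | ⟨a, c, ha, rfl⟩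
    · exact ⟨a, ha, fun x y hx hxy => lt_of_lt_of_le hx hxy⟩
    · exact ⟨a, ha, fun x y hx hxy => le_trans hx hxy⟩
  let f : Plane →ₗ[ℝ] ℝ := innerₗ Plane a
  -- The direction orthogonal to `a` separates points on a common line parallel to the boundary,
  -- which makes the lexicographic key injective.
  let g : Plane →ₗ[ℝ] ℝ := innerₗ Plane !₂[-a 1, a 0]
  have hf : ∀ x, f x = a 0 * x 0 + a 1 * x 1 := fun x => by
    simp [f, PiLp.inner_apply, Fin.sum_univ_two]; ring
  have hg : ∀ x, g x = -a 1 * x 0 + a 0 * x 1 := fun x => by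
    simp [g, PiLp.inner_apply, Fin.sum_univ_two]; ring
  have hpos : a 0 ^ 2 + a 1 ^ 2 ≠ 0 := fun h0 => ha <| by
    have h1 : a 0 = 0 := by nlinarith [sq_nonneg (a 0), sq_nonneg (a 1)]
    have h2 : a 1 = 0 := by nlinarith [sq_nonneg (a 0), sq_nonneg (a 1)]
    ext i; fin_cases i <;> simp [h1, h2]
  have hkey : Function.Injective (fun x => toLex (f x, g x)) := by
    intro x y hxy
    have hxy' := Prod.ext_iff.1 (toLex.injective hxy)
    obtain ⟨e1, e2⟩ := hxy'
    simp only [hf, hg] at e1 e2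
    ext i
    fin_cases i
    · change x 0 = y 0
      exact mul_left_cancel₀ hpos (by linear_combination a 0 * e1 - a 1 * e2)
    · change x 1 = y 1
      exact mul_left_cancel₀ hpos (by linear_combination a 1 * e1 + a 0 * e2)
  obtain ⟨t, ht, htm⟩ := exists_card_filter_le_eq _ hkey hm _ hcard
  have hsub : ∀ p ∈ P, toLex (f t, g t) ≤ toLex (f p, g p) → p ∈ R := fun p _ hle => by
    refine hup t p (Finset.mem_filter.1 ht).2 ?_
    rcases Prod.Lex.toLex_le_toLex.1 hle with h | h
    exacts [h.le, h.1.le]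
  refine ⟨_, isHemispace_lex f g (f t) (g t), hsub, ?_⟩
  rw [← htm]
  congr 1
  ext p
  simp only [Finset.mem_filter, Set.mem_ofPred_eq]
  exact ⟨fun ⟨h1, h2⟩ => ⟨⟨h1, hsub p h1 h2⟩, h2⟩, fun ⟨h1, h2⟩ => ⟨h1.1, h2⟩⟩

/-! ### Upper bound -/

open Classical in
-- Writing the bound as `2 * k ≤ card + 1` avoids truncated subtraction at `k = 0`. Coloring the
-- whole plane lets the induction pass to `P \ N` without changing types.
theorem exists_coloring (k : ℕ) : ∀ P : Finset Plane, ∃ χ : Plane → ℕ, ∀ R ∈ halfPlanes,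
    2 * k ≤ (P.filter (· ∈ R)).card + 1 → ∀ i < k, ∃ p ∈ P, p ∈ R ∧ χ p = i := by
  induction k with
  | zero => exact fun P => ⟨fun _ => 0, fun _ _ _ i hi => absurd hi (Nat.not_lt_zero i)⟩
  | succ k ih =>
    intro P
    obtain ⟨N, hNP, hN⟩ := exists_sparse_hitting_set P (m := 2 * k + 1) (by omega)
    obtain ⟨χ, hχ⟩ := ih (P \ N)
    refine ⟨fun p => if p ∈ N then k else χ p, fun R hR hcard i hi => ?_⟩
    obtain ⟨h, hh, hhR, hhm⟩ :=
      exists_hemispace_card_eq P hR (m := 2 * k + 1) (by omega) (by omega)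
    obtain rfl | hik : i = k ∨ i < k := by omega
    · obtain ⟨p, hpN, hph⟩ := (hN h hh).1 hhm.ge
      exact ⟨p, hNP hpN, hhR p (hNP hpN) hph, if_pos hpN⟩
    -- `R` itself may contain many points of `N`. Counting inside `h` suffices: at least `2k + 1 -
    -- 2` of its points avoid `N`, and they all lie in `R`.
    · have h2 := (hN h hh).2 hhm
      have hsub : P.filter (· ∈ h) ⊆ (P \ N).filter (· ∈ R) ∪ N.filter (· ∈ h) := by
        intro p hp
        obtain ⟨hpP, hph⟩ := Finset.mem_filter.1 hp
        by_cases hpN : p ∈ N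
        · exact Finset.mem_union_right _ (Finset.mem_filter.2 ⟨hpN, hph⟩)
        · exact Finset.mem_union_left _ (Finset.mem_filter.2
            ⟨Finset.mem_sdiff.2 ⟨hpP, hpN⟩, hhR p hpP hph⟩)
      have h3 := (Finset.card_le_card hsub).trans (Finset.card_union_le _ _)
      obtain ⟨p, hp, hpR, hpi⟩ := hχ R hR (by omega) i hik
      obtain ⟨hpP, hpN⟩ := Finset.mem_sdiff.1 hp
      exact ⟨p, hpP, hpR, (if_neg hpN).trans hpi⟩

theorem isThreshold_halfPlanes {k : ℕ} (hk : 1 ≤ k) : IsThreshold halfPlanes k (2 * k - 1) := by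
  classical
  intro P
  obtain ⟨χ, hχ⟩ := exists_coloring k P
  refine ⟨fun p => ⟨χ p % k, Nat.mod_lt _ hk⟩, fun R hR hcard i => ?_⟩
  have hset : (P : Set Plane) ∩ R = (P.filter (· ∈ R) : Finset Plane) := by
    ext; simp
  rw [hset, Set.ncard_coe_finset] at hcard
  obtain ⟨p, hp, hpR, hpi⟩ := hχ R hR (by omega) i i.2
  exact ⟨⟨p, hp⟩, hpR, Fin.ext (by simp [hpi, Nat.mod_eq_of_lt i.2])⟩

/-! ### Lower bound -/

/-- Among fewer than `2 k` points, some color of a `k`-coloring is used at most once. -/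
theorem exists_color_card_le_one {α : Type*} {k : ℕ} (Γ : Finset α)
    (hΓ : Γ.card < 2 * k) (χ : α → Fin k) :
    ∃ c, ∀ p ∈ Γ, ∀ q ∈ Γ, χ p = c → χ q = c → p = q := by
  classical
  obtain ⟨c, -, hc⟩ := Finset.exists_card_fiber_lt_of_card_lt_mul (s := Γ) (t := Finset.univ)
    (f := χ) (n := 2) (by simpa [mul_comm] using hΓ)
  refine ⟨c, fun p hp q hq hpc hqc => ?_⟩
  exact Finset.card_le_one.1 (Nat.lt_succ_iff.1 hc) p (by simp [hp, hpc]) q (by simp [hq, hqc])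

/-- The open half-plane above the tangent of the parabola `y = x ^ 2` at abscissa `t`. -/
theorem above_tangent_mem_openHalfPlanes (t : ℝ) :
    {x : Plane | 2 * t * x 0 - t ^ 2 < x 1} ∈ openHalfPlanes := by
  refine ⟨!₂[-2 * t, 1], -t ^ 2, fun h => ?_, ?_⟩
  · simpa using congrArg (fun v : Plane => v 1) h
  · ext x
    simp only [Set.mem_ofPred_eq, PiLp.inner_apply, Fin.sum_univ_two]
    simp
    constructor <;> intro h <;> linarith

theorem exists_bad_points {k : ℕ} (hk : 1 ≤ k) (n : ℕ) (hn : 2 * k - 1 ≤ n) :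
    ∃ P Γ : Finset Plane, P.card = n ∧ Γ ⊆ P ∧ Γ.card = 2 * k - 1 ∧
      (∀ p ∈ Γ, p 1 = (p 0) ^ 2 ∧ -1 < p 0 ∧ p 0 < 1) ∧
      ∀ χ : {p : Plane // p ∈ P} → Fin k,
        ∃ h ∈ openHalfPlanes, (P : Set Plane) ∩ h ⊆ (Γ : Set Plane) ∧
          ((P : Set Plane) ∩ h).ncard = 2 * k - 2 ∧ ¬ IsPolychromatic χ h := by
  classical
  -- The abscissas `1 / (i + 2)` are distinct and lie in `(0, 1)`. The padding points `w j` have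
  -- height at most `-1`, below every tangent used: at abscissa `0` the tangent at `t` has height
  -- `-t ^ 2 > -1`.
  let u : ℕ → Plane := fun i => !₂[1 / ((i : ℝ) + 2), (1 / ((i : ℝ) + 2)) ^ 2]
  let w : ℕ → Plane := fun j => !₂[0, -1 - (j : ℝ)]
  have hu : Function.Injective u := fun i j hij => by
    have h0 := congrArg (fun v : Plane => v 0) hij
    simpa [u] using h0
  have hw : Function.Injective w := fun i j hij => by
    have h1 := congrArg (fun v : Plane => v 1) hij
    simpa [w] using h1
  let Γ := (Finset.range (2 * k - 1)).image u
  let D := (Finset.range (n - (2 * k - 1))).image w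
  have hΓcard : Γ.card = 2 * k - 1 := by
    rw [Finset.card_image_of_injective _ hu, Finset.card_range]
  have hΓ : ∀ p ∈ Γ, p 1 = (p 0) ^ 2 ∧ -1 < p 0 ∧ p 0 < 1 := by
    intro p hp
    obtain ⟨i, -, rfl⟩ := Finset.mem_image.1 hp
    have hi : (0 : ℝ) ≤ i := i.cast_nonneg
    have h0 : 0 < 1 / ((i : ℝ) + 2) := by positivity
    have h1 : 1 / ((i : ℝ) + 2) < 1 := by
      rw [div_lt_one (by positivity)]; linarith
    refine ⟨by simp [u], ?_, ?_⟩
    · change -1 < 1 / ((i : ℝ) + 2)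
      linarith
    · exact h1
  have hD : ∀ p ∈ D, p 0 = 0 ∧ p 1 ≤ -1 := by
    intro p hp
    obtain ⟨i, -, rfl⟩ := Finset.mem_image.1 hp
    simp [w]
  have hdisj : Disjoint Γ D := Finset.disjoint_left.2 fun p hp hp' => by
    have h1 := (hΓ p hp).1
    have h2 := (hD p hp').2
    nlinarith [sq_nonneg (p 0)]
  have hinter : ∀ t ∈ Γ, ((Γ ∪ D : Finset Plane) : Set Plane) ∩
      {x : Plane | 2 * t 0 * x 0 - t 0 ^ 2 < x 1} = (Γ.erase t : Finset Plane) := by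
    intro t ht
    obtain ⟨ht1, ht2, ht3⟩ := hΓ t ht
    ext x
    simp only [Set.mem_inter_iff, Finset.mem_coe, Finset.mem_union, Set.mem_ofPred_eq,
      Finset.mem_erase]
    constructor
    · rintro ⟨hx | hx, hlt⟩
      · refine ⟨?_, hx⟩
        rintro rfl
        linarith
      · obtain ⟨h0, h1⟩ := hD x hx
        rw [h0] at hlt
        nlinarith
    · rintro ⟨hne, hx⟩
      refine ⟨Or.inl hx, ?_⟩
      have hx1 := (hΓ x hx).1
      have hne0 : x 0 - t 0 ≠ 0 := fun h => hne <| by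
        have h0 : x 0 = t 0 := sub_eq_zero.1 h
        ext i
        fin_cases i
        · exact h0
        · change x 1 = t 1
          rw [hx1, ht1, h0]
      -- On the parabola, the height above the tangent is `(x 0 - t 0) ^ 2`.
      have := pow_pos (abs_pos.2 hne0) 2
      rw [sq_abs] at this
      nlinarith
  refine ⟨Γ ∪ D, Γ, ?_, Finset.subset_union_left, hΓcard, hΓ, fun χ => ?_⟩
  · rw [Finset.card_union_of_disjoint hdisj, hΓcard, Finset.card_image_of_injective _ hw,
      Finset.card_range]
    omega
  let χ' : Plane → Fin k := fun p => if hp : p ∈ Γ ∪ D then χ ⟨p, hp⟩ else ⟨0, hk⟩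
  have hχ' : ∀ p : {p : Plane // p ∈ Γ ∪ D}, χ' p = χ p := fun p => dif_pos p.2
  obtain ⟨c, hc⟩ := exists_color_card_le_one Γ (by omega) χ'
  obtain ⟨t, ht, htc⟩ : ∃ t ∈ Γ, ∀ p ∈ Γ, χ' p = c → p = t := by
    by_cases hex : ∃ t ∈ Γ, χ' t = c
    · obtain ⟨t, ht, e⟩ := hex
      exact ⟨t, ht, fun p hp hpc => hc p hp t ht hpc e⟩
    -- If the color is absent from `Γ`, any tangent point will do.
    · push Not at hex
      obtain ⟨t, ht⟩ := Finset.card_pos.1 (show 0 < Γ.card by omega)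
      exact ⟨t, ht, fun p hp hpc => absurd hpc (hex p hp)⟩
  refine ⟨_, above_tangent_mem_openHalfPlanes (t 0), ?_, ?_, ?_⟩
  · rw [hinter t ht]
    exact_mod_cast Finset.erase_subset t Γ
  · rw [hinter t ht, Set.ncard_coe_finset, Finset.card_erase_of_mem ht]
    omega
  · intro hpoly
    obtain ⟨p, hp, hpc⟩ := hpoly c
    have hmem : (p : Plane) ∈ (Γ.erase t : Finset Plane) := by
      have : (p : Plane) ∈ ((Γ.erase t : Finset Plane) : Set Plane) := by
        rw [← hinter t ht]
        exact ⟨p.2, hp⟩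
      exact this
    obtain ⟨hne, hpΓ⟩ := Finset.mem_erase.1 hmem
    exact hne (htc p hpΓ ((hχ' p).trans hpc))

end PolychromaticColoring

open PolychromaticColoring in
theorem theorem1 (k : ℕ) (hk : 1 ≤ k) :
    PolychromaticNumberEq halfPlanes k (2 * k - 1) ∧
    ∀ n : ℕ, 2 * k - 1 ≤ n →
      ∃ P Γ : Finset Plane, P.card = n ∧ Γ ⊆ P ∧ Γ.card = 2 * k - 1 ∧
        (∀ p ∈ Γ, p 1 = (p 0) ^ 2 ∧ -1 < p 0 ∧ p 0 < 1) ∧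
        ∀ χ : {p : Plane // p ∈ P} → Fin k,
          ∃ h ∈ openHalfPlanes, (P : Set Plane) ∩ h ⊆ (Γ : Set Plane) ∧
            ((P : Set Plane) ∩ h).ncard = 2 * k - 2 ∧ ¬ IsPolychromatic χ h := by
  refine ⟨⟨isThreshold_halfPlanes hk, fun f hf => ?_⟩, exists_bad_points hk⟩
  by_contra! hlt
  obtain ⟨P, Γ, -, -, -, -, hbad⟩ := exists_bad_points hk _ le_rfl
  obtain ⟨χ, hχ⟩ := hf P
  obtain ⟨h, hh, -, hcard, hnot⟩ := hbad χ
  exact hnot (hχ h (Or.inl hh) (by omega))
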